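/- Let $d\ge 2$ and let $\Lambda\subset\mathbb R^d$ be a unimodular lattice (full rank, covolume $1$), with dual lattice $\Lambda^*=\{y\in\mathbb R^d:\langle y,x\rangle\in\mathbb Z\text{ for all }x\in\Lambda\}$. Let $|\cdot|$ be the sup-norm on $\mathbb R^d$, let $\mathcal T=\{\tau\in\mathbb R^d:\tau_1+\dots+\tau_d=0\}$, and for $\tau\in\mathcal T$ put $|\tau|_+=\max_{1\le i\le d}\tau_i$ and $\mathcal B_\tau=\mathrm{diag}(e^{\tau_1},\dots,e^{\tau_d})\{x\in\mathbb R^d:|x|\le 1\}$. For a lattice $M\subset\mathbb R^d$ and $1\le k\le d$ let $\lambda_k(\mathcal B_\tau,M)$ be the $k$-th successive minimum, i.e. the infimum of all $\lambda>0$ such that $\lambda\mathcal B_\tau$ contains at least $k$ linearly independent vectors of $M$, and define the lower Schmidt–Summerer exponents of the second type with respect to $f(\tau)=|\tau|_+$ by $$\underline\Psi_k(M)=\liminf_{\tau\in\mathcal T,\ |\tau|\to\infty}\ \sum_{j=1}^{k}\frac{\log\lambda_j(\mathcal B_\tau,M)}{|\tau|_+}.$$ Then $$\underline\Psi_1(\Lambda)\le\dots\le\frac{\underline\Psi_k(\Lambda)}{k}\le\dots\le\frac{\underline\Psi_{d-1}(\Lambda)}{d-1}\le\frac{\underline\Psi_1(\Lambda^*)}{(d-1)^2}.$$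 In particular, $\underline\Psi_1(\Lambda)\le\underline\Psi_1(\Lambda^*)/(d-1)^2$. -/

import Mathlib

noncomputable section

namespace MulGeom

open scoped Pointwise

/-- The space `𝒯` of all `τ ∈ ℝ^d` with `τ₁ + … + τ_d = 0`. Being a subspace of `Fin d → ℝ`,
it carries the sup-norm. -/
def traceZero (d : ℕ) : Submodule ℝ (Fin d → ℝ) where
  carrier := {τ | ∑ i, τ i = 0}
  add_mem' := by
    intro a b ha hb
    simp only [Set.mem_ofPred_eq] at ha hb ⊢
    simp [Finset.sum_add_distrib, ha, hb]
  zero_mem' := by simp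
  smul_mem' := by
    intro c a ha
    simp only [Set.mem_ofPred_eq] at ha ⊢
    simp [← Finset.mul_sum, ha]

/-- The functional `|τ|₊ = max τ_i` on `𝒯`. -/
def plusPart {d : ℕ} (τ : traceZero d) : ℝ := ⨆ i, (τ : Fin d → ℝ) i

/-- The parallelepiped `ℬ_τ = D_τ ℬ`, where `D_τ = diag(e^{τ₁}, …, e^{τ_d})` and `ℬ` is the closed
unit ball of the sup-norm (the norm of `Fin d → ℝ`). -/
def box {d : ℕ} (τ : Fin d → ℝ) : Set (Fin d → ℝ) :=
  (Matrix.diagonal fun i => Real.exp (τ i)).mulVec '' Metric.closedBall 0 1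

/-- The `k`-th successive minimum of a set `B` with respect to `Λ`: the infimum of all positive `r`
such that `r B` contains at least `k` linearly independent vectors of `Λ`. -/
def succMin {d : ℕ} (Λ : Submodule ℤ (Fin d → ℝ)) (B : Set (Fin d → ℝ)) (k : ℕ) : ℝ :=
  sInf {r : ℝ | 0 < r ∧ ∃ v : Fin k → (Fin d → ℝ),
    LinearIndependent ℝ v ∧ ∀ i, v i ∈ Λ ∧ v i ∈ r • B}

/-- `L_k(τ, Λ) = log λ_k(ℬ_τ, Λ)`. -/
def logMin {d : ℕ} (Λ : Submodule ℤ (Fin d → ℝ)) (k : ℕ) (τ : traceZero d) : ℝ :=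
  Real.log (succMin Λ (box (τ : Fin d → ℝ)) k)

/-- `ψ_k(τ, Λ, f) = L_k(τ, Λ) / f(τ)`. -/
def psi {d : ℕ} (Λ : Submodule ℤ (Fin d → ℝ)) (f : traceZero d → ℝ) (k : ℕ)
    (τ : traceZero d) : ℝ :=
  logMin Λ k τ / f τ

/-- `Ψ_k(τ, Λ, f) = ∑_{1 ≤ j ≤ k} ψ_j(τ, Λ, f)`. -/
def bigPsi {d : ℕ} (Λ : Submodule ℤ (Fin d → ℝ)) (f : traceZero d → ℝ) (k : ℕ)
    (τ : traceZero d) : ℝ :=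
  ∑ j ∈ Finset.Icc 1 k, psi Λ f j τ

/-- The `k`-th lower Schmidt–Summerer exponent of the second type: the lower limit of
`Ψ_k(τ, Λ, f)` as `|τ| → ∞`, `τ ∈ 𝒯`, taken in the extended real line. -/
def lowerExponent {d : ℕ} (Λ : Submodule ℤ (Fin d → ℝ)) (f : traceZero d → ℝ) (k : ℕ) : EReal :=
  Filter.liminf (fun τ : traceZero d => (bigPsi Λ f k τ : EReal))
    (Filter.comap (fun τ : traceZero d => ‖τ‖) Filter.atTop)

/-- The dual lattice `Λ* = {y | ⟨y, x⟩ ∈ ℤ for each x ∈ Λ}`. -/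
def dualLattice {d : ℕ} (Λ : Submodule ℤ (Fin d → ℝ)) : Submodule ℤ (Fin d → ℝ) where
  carrier := {y | ∀ x ∈ Λ, ∃ n : ℤ, ∑ i, y i * x i = n}
  add_mem' := by
    intro a b ha hb x hx
    obtain ⟨m, hm⟩ := ha x hx
    obtain ⟨n, hn⟩ := hb x hx
    exact ⟨m + n, by simp [add_mul, Finset.sum_add_distrib, hm, hn]⟩
  zero_mem' := fun x _ => ⟨0, by simp⟩
  smul_mem' := by
    intro c a ha x hx
    obtain ⟨m, hm⟩ := ha x hx
    exact ⟨c * m, by simp [mul_assoc, ← Finset.mul_sum, hm]⟩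

end MulGeom

end

/-! Write L_k for `logMin`. Since L_1 ≤ … ≤ L_d, the averages (L_1 + … + L_k)/k increase with k.
Dividing by |τ|_+ ≥ 0 and taking lower limits gives the chain. The last inequality rests on two
facts. Minkowski's second theorem bounds L_1 + … + L_d from above (`exists_sum_logMin_le`), and
pairing Λ with Λ* gives L_1(τ, Λ*) + L_d(-τ, Λ) ≥ -log d (`neg_log_le_logMin_add`). Hence the first
d - 1 terms at -τ for Λ sum to at most L_1(τ, Λ*) + O(1). As L_1(τ, Λ*) is bounded above and |-τ|_+
≤ (d-1)|τ|_+, replacing the denominator |-τ|_+ by (d-1)|τ|_+ costs only o(1) and yields one factor d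
- 1. Averaging over d - 1 terms yields the other. -/

namespace MulGeom

/-! ### Greedy vectors and the Gram–Schmidt stretching. -/

/-- Greedy choice of linearly independent vectors of minimal norm. -/
theorem exists_greedy_basis {E : Type*} [NormedAddCommGroup E] [NormedSpace ℝ E]
    [FiniteDimensional ℝ E] {d : ℕ} (hd : Module.finrank ℝ E = d) (L : Set E)
    (hspan : Submodule.span ℝ L = ⊤)
    (hfin : ∀ R : ℝ, {x ∈ L | ‖x‖ ≤ R}.Finite) :
    ∃ v : Fin d → E, LinearIndependent ℝ v ∧ (∀ i, v i ∈ L) ∧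
      ∀ i, ∀ x ∈ L, x ∉ Submodule.span ℝ (v '' Set.Iio i) → ‖v i‖ ≤ ‖x‖ := by
  suffices H : ∀ n ≤ d, ∃ v : Fin n → E, LinearIndependent ℝ v ∧ (∀ i, v i ∈ L) ∧
      ∀ i, ∀ x ∈ L, x ∉ Submodule.span ℝ (v '' Set.Iio i) → ‖v i‖ ≤ ‖x‖ from H d le_rfl
  intro n
  induction n with
  | zero => exact fun _ => ⟨Fin.elim0, linearIndependent_empty_type, fun i => i.elim0,
      fun i => i.elim0⟩
  | succ n ih =>
    intro hn
    obtain ⟨v, hv, hvL, hmin⟩ := ih (by omega)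
    have hex : ∃ x ∈ L, x ∉ Submodule.span ℝ (Set.range v) := by
      by_contra! h
      have h1 : (⊤ : Submodule ℝ E) ≤ Submodule.span ℝ (Set.range v) := by
        rw [← hspan]
        exact Submodule.span_le.2 h
      have h2 : Module.finrank ℝ (Submodule.span ℝ (Set.range v)) = d := by
        rw [top_le_iff.1 h1, finrank_top, hd]
      have h3 := finrank_range_le_card (R := ℝ) v
      rw [Set.finrank, h2, Fintype.card_fin] at h3
      omega
    obtain ⟨y, hyL, hy⟩ := hex
    -- Cutting off at `‖y‖` leaves a finite set, so a minimum is attained; longer vectors cannot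
    -- compete.
    obtain ⟨x, ⟨⟨hxL, hxy⟩, hx⟩, hxmin⟩ := Set.exists_min_image
      ({x ∈ L | ‖x‖ ≤ ‖y‖} ∩ {x | x ∉ Submodule.span ℝ (Set.range v)}) (fun x => ‖x‖)
      ((hfin ‖y‖).inter_of_left _) ⟨y, ⟨hyL, le_rfl⟩, hy⟩
    refine ⟨Fin.snoc v x, hv.finSnoc hx, fun i => ?_, fun i => ?_⟩
    · induction i using Fin.lastCases with
      | last => simpa using hxL
      | cast i => simpa using hvL i
    · induction i using Fin.lastCases with
      | last =>
        intro z hz hzs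
        have hrange : Fin.snoc (α := fun _ => E) v x '' Set.Iio (Fin.last n) = Set.range v := by
          ext w
          constructor
          · rintro ⟨j, hj, rfl⟩
            induction j using Fin.lastCases with
            | last => exact absurd (Set.mem_Iio.1 hj) (lt_irrefl _)
            | cast j => exact ⟨j, by simp⟩
          · rintro ⟨j, rfl⟩
            exact ⟨j.castSucc, Fin.castSucc_lt_last j, by simp⟩
        rw [hrange] at hzs
        rw [Fin.snoc_last]
        by_cases hzy : ‖z‖ ≤ ‖y‖
        · exact hxmin z ⟨⟨hz, hzy⟩, hzs⟩
        · exact hxy.trans (not_le.1 hzy).le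
      | cast i =>
        intro z hz hzs
        rw [Fin.snoc_castSucc]
        refine hmin i z hz fun h => hzs (Submodule.span_mono ?_ h)
        rintro _ ⟨j, hj, rfl⟩
        exact ⟨j.castSucc, Fin.castSucc_lt_castSucc_iff.2 hj, by simp⟩

/-- A linear map of determinant `∏ ‖v i‖⁻¹` that carries the nonzero points of `L` outside the open
unit ball, where `v` realizes the greedy minima of `L`. -/
theorem exists_linearMap_one_le_norm {E : Type*} [NormedAddCommGroup E] [InnerProductSpace ℝ E]
    [FiniteDimensional ℝ E] {d : ℕ} (hd : Module.finrank ℝ E = d) {L : Set E} {v : Fin d → E}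
    (hv : LinearIndependent ℝ v) (hvL : ∀ i, v i ∈ L)
    (hmin : ∀ i, ∀ x ∈ L, x ∉ Submodule.span ℝ (v '' Set.Iio i) → ‖v i‖ ≤ ‖x‖) :
    ∃ T : E →ₗ[ℝ] E, LinearMap.det T = ∏ i, ‖v i‖⁻¹ ∧ ∀ x ∈ L, x ≠ 0 → 1 ≤ ‖T x‖ := by
  have hcard : Module.finrank ℝ E = Fintype.card (Fin d) := by simpa using hd
  set b := InnerProductSpace.gramSchmidtOrthonormalBasis hcard v with hb
  have hpos : ∀ i, 0 < ‖v i‖ := fun i => norm_pos_iff.2 (hv.ne_zero i)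
  have hmono : ∀ i k, i ≤ k → ‖v i‖ ≤ ‖v k‖ := by
    intro i k hik
    refine hmin i _ (hvL k) ?_
    exact hv.notMem_span_image (by simpa using hik)
  -- Rescale the `i`-th Gram–Schmidt direction by `‖v i‖⁻¹`.
  refine ⟨Matrix.toLin b.toBasis b.toBasis (Matrix.diagonal fun i => ‖v i‖⁻¹), ?_, ?_⟩
  · rw [LinearMap.det_toLin, Matrix.det_diagonal]
  · intro x hx hx0
    have hT : ∀ i, b.repr (Matrix.toLin b.toBasis b.toBasis
        (Matrix.diagonal fun i => ‖v i‖⁻¹) x) i = ‖v i‖⁻¹ * b.repr x i := by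
      intro i
      have := congrFun (LinearMap.toMatrix_mulVec_repr b.toBasis b.toBasis
        (Matrix.toLin b.toBasis b.toBasis (Matrix.diagonal fun i => ‖v i‖⁻¹)) x) i
      rw [LinearMap.toMatrix_toLin, Matrix.mulVec_diagonal] at this
      simpa using this.symm
    have hne : (Finset.univ.filter fun i => b.repr x i ≠ 0).Nonempty := by
      by_contra h
      rw [Finset.not_nonempty_iff_eq_empty, Finset.filter_eq_empty_iff] at h
      refine hx0 (b.repr.injective ?_)
      ext i
      simpa using h (Finset.mem_univ i)
    -- With `k` the last nonzero coordinate, `x` is outside the span of the earlier `v j`, so `‖v k‖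
    -- ≤ ‖x‖`; every coordinate present is multiplied by at least `‖v k‖⁻¹`.
    obtain ⟨k, hk, hkmax⟩ := Finset.exists_max_image _ id hne
    rw [Finset.mem_filter] at hk
    have hxk : ‖v k‖ ≤ ‖x‖ := by
      refine hmin k x hx fun hmem => hk.2 ?_
      rw [b.repr_apply_apply]
      have hle : Submodule.span ℝ (v '' Set.Iio k) ≤ LinearMap.ker (innerₛₗ ℝ (b k)) := by
        rw [Submodule.span_le]
        rintro _ ⟨j, hj, rfl⟩
        exact InnerProductSpace.gramSchmidtOrthonormalBasis_inv_triangular hcard v hj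
      exact hle hmem
    have key : (‖x‖ * ‖v k‖⁻¹) ^ 2 ≤ ‖Matrix.toLin b.toBasis b.toBasis
        (Matrix.diagonal fun i => ‖v i‖⁻¹) x‖ ^ 2 := by
      rw [← b.repr.norm_map (Matrix.toLin _ _ _ x), EuclideanSpace.norm_sq_eq, mul_pow,
        ← b.repr.norm_map x, EuclideanSpace.norm_sq_eq, Finset.sum_mul]
      refine Finset.sum_le_sum fun i _ => ?_
      rw [hT, norm_mul, mul_pow, mul_comm]
      by_cases hi : b.repr x i = 0
      · simp [hi]
      · have hik : i ≤ k := hkmax i (by simp [hi])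
        rw [norm_inv, norm_norm]
        have := inv_anti₀ (hpos i) (hmono i k hik)
        have h0 := inv_nonneg.2 (hpos k).le
        gcongr
    have h1 : 1 ≤ ‖x‖ * ‖v k‖⁻¹ := by
      rw [← div_eq_mul_inv]
      exact (one_le_div (hpos k)).2 hxk
    exact h1.trans (le_of_sq_le_sq key (norm_nonneg _))

end MulGeom

/-! ### Minkowski's second theorem for boxes, and the dual lattice. -/

namespace MulGeom

open MeasureTheory
open scoped Pointwise

theorem mem_smul_box_iff {d : ℕ} (τ : Fin d → ℝ) {r : ℝ} (hr : 0 < r) (x : Fin d → ℝ) :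
    x ∈ r • box τ ↔ ∀ i, |x i| ≤ r * Real.exp (τ i) := by
  rw [Set.mem_smul_set_iff_inv_smul_mem₀ hr.ne']
  constructor
  · rintro ⟨y, hy, hyx⟩ i
    have hyi : |y i| ≤ 1 := by
      have := norm_le_pi_norm y i
      rw [mem_closedBall_zero_iff] at hy
      exact (Real.norm_eq_abs _ ▸ this).trans hy
    have h := congrFun hyx i
    rw [Matrix.mulVec_diagonal, Pi.smul_apply, smul_eq_mul] at h
    have hx : x i = r * (Real.exp (τ i) * y i) := by
      rw [h, mul_inv_cancel_left₀ hr.ne']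
    rw [hx, abs_mul, abs_mul, abs_of_pos hr, Real.abs_exp]
    have := mul_le_of_le_one_right (Real.exp_pos (τ i)).le hyi
    gcongr
  · intro h
    refine ⟨fun i => Real.exp (-τ i) * (r⁻¹ * x i), ?_, ?_⟩
    · rw [mem_closedBall_zero_iff, pi_norm_le_iff_of_nonneg zero_le_one]
      intro i
      rw [Real.norm_eq_abs, abs_mul, abs_mul, Real.abs_exp, abs_inv, abs_of_pos hr]
      calc Real.exp (-τ i) * (r⁻¹ * |x i|)
          ≤ Real.exp (-τ i) * (r⁻¹ * (r * Real.exp (τ i))) := by gcongr; exact h i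
        _ = 1 := by
          rw [inv_mul_cancel_left₀ hr.ne', ← Real.exp_add, neg_add_cancel, Real.exp_zero]
    · ext i
      rw [Matrix.mulVec_diagonal, ← mul_assoc, ← Real.exp_add, add_neg_cancel, Real.exp_zero,
        one_mul]
      rfl

/-- The map `D_τ`, from the Euclidean space. -/
noncomputable def diagEquiv {d : ℕ} (τ : Fin d → ℝ) : EuclideanSpace ℝ (Fin d) ≃ₗ[ℝ] (Fin d → ℝ) where
  toFun x i := Real.exp (τ i) * x i
  invFun y := WithLp.toLp 2 fun i => Real.exp (-τ i) * y i
  map_add' x y := by ext i; simp [mul_add]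
  map_smul' c x := by ext i; simp; ring
  left_inv x := by ext i; simp [← mul_assoc, ← Real.exp_add]
  right_inv x := by ext i; simp [← mul_assoc, ← Real.exp_add]

theorem volume_diagEquiv_image {d : ℕ} {τ : Fin d → ℝ} (hτ : ∑ i, τ i = 0)
    {S : Set (EuclideanSpace ℝ (Fin d))} (hS : MeasurableSet S) :
    volume (diagEquiv τ '' S) = volume S := by
  have h1 : diagEquiv τ '' S = Matrix.toLin' (Matrix.diagonal fun i => Real.exp (τ i)) ''
      (WithLp.toLp 2 ⁻¹' S) := by
    ext y
    constructor
    · rintro ⟨x, hx, rfl⟩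
      refine ⟨WithLp.ofLp x, hx, ?_⟩
      ext i
      simp [diagEquiv, Matrix.mulVec_diagonal]
    · rintro ⟨x, hx, rfl⟩
      refine ⟨WithLp.toLp 2 x, hx, ?_⟩
      ext i
      simp [diagEquiv, Matrix.mulVec_diagonal]
  rw [h1, Measure.addHaar_image_linearMap, LinearMap.det_toLin', Matrix.det_diagonal,
    ← Real.exp_sum, hτ, Real.exp_zero, abs_one, ENNReal.ofReal_one, one_mul,
    (PiLp.volume_preserving_toLp (Fin d)).measure_preimage hS.nullMeasurableSet]

/-- **Minkowski's second theorem** for the parallelepipeds `ℬ_τ`, up to a constant. -/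
theorem exists_basis_prod_le {d : ℕ} (Λ : Submodule ℤ (Fin d → ℝ))
    [DiscreteTopology Λ] [IsZLattice ℝ Λ] :
    ∃ C : ℝ, ∀ τ : Fin d → ℝ, ∑ i, τ i = 0 → ∃ (v : Fin d → (Fin d → ℝ)) (μ : Fin d → ℝ),
      LinearIndependent ℝ v ∧ (∀ i, v i ∈ Λ) ∧ (∀ i, 0 < μ i) ∧ Monotone μ ∧
      (∀ i, v i ∈ μ i • box τ) ∧ ∏ i, μ i ≤ C := by
  obtain ⟨F, hF, hFtop⟩ : ∃ F : Set (Fin d → ℝ),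
      IsAddFundamentalDomain Λ.toAddSubgroup F volume ∧ volume F < ⊤ := by
    let b := Module.Free.chooseBasis ℤ Λ
    exact ⟨_, ZLattice.isAddFundamentalDomain b volume,
      (ZSpan.fundamentalDomain_isBounded (b.ofZLatticeBasis ℝ Λ)).measure_lt_top⟩
  set B : Set (EuclideanSpace ℝ (Fin d)) := Metric.ball 0 1 with hB
  have hBpos : 0 < volume B := Metric.measure_ball_pos _ _ one_pos
  have hBtop : volume B ≠ ⊤ := measure_ball_lt_top.ne
  have : DiscreteTopology Λ.toAddSubgroup := inferInstanceAs (DiscreteTopology Λ)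
  have : Countable Λ.toAddSubgroup := inferInstanceAs (Countable Λ)
  refine ⟨(volume F).toReal * 2 ^ d / (volume B).toReal, fun τ hτ => ?_⟩
  set φ := diagEquiv τ with hφ
  -- The greedy choice uses the Euclidean norm because Gram–Schmidt needs an inner product. It
  -- dominates the sup-norm, so the vectors still lie in the required boxes.
  set L : Set (EuclideanSpace ℝ (Fin d)) := φ ⁻¹' Λ with hL
  have hd : Module.finrank ℝ (EuclideanSpace ℝ (Fin d)) = d := by simp
  have hspan : Submodule.span ℝ L = ⊤ := by
    have h1 : L = φ.symm '' Λ := (φ.toEquiv.image_symm_eq_preimage _).symm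
    have h2 := IsZLattice.span_top (K := ℝ) (L := Λ)
    have h3 := Submodule.map_span (φ.symm : (Fin d → ℝ) →ₗ[ℝ] EuclideanSpace ℝ (Fin d)) Λ
    rw [h2, Submodule.map_top, LinearEquiv.range] at h3
    rw [h1]
    exact h3.symm
  have hfin : ∀ R : ℝ, {x ∈ L | ‖x‖ ≤ R}.Finite := by
    intro R
    have hcont : Continuous φ := φ.toLinearMap.continuous_of_finiteDimensional
    have hbdd : Bornology.IsBounded (φ '' Metric.closedBall 0 R) :=
      ((isCompact_closedBall 0 R).image hcont).isBounded
    have hclosed : IsClosed (Λ.toAddSubgroup : Set (Fin d → ℝ)) :=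
      AddSubgroup.isClosed_of_discrete
    have hf := Metric.finite_isBounded_inter_isClosed
      (s := (Λ.toAddSubgroup : Set (Fin d → ℝ))) DiscreteTopology.isDiscrete hbdd hclosed
    refine (hf.preimage φ.injective.injOn).subset ?_
    rintro x ⟨hx, hxR⟩
    exact ⟨⟨x, by simpa using hxR, rfl⟩, hx⟩
  obtain ⟨w, hw, hwL, hmin⟩ := exists_greedy_basis hd L hspan hfin
  obtain ⟨T, hdet, hT⟩ := exists_linearMap_one_le_norm hd hw hwL hmin
  have hpos : ∀ i, 0 < ‖w i‖ := fun i => norm_pos_iff.2 (hw.ne_zero i)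
  have hPpos : 0 < ∏ i, ‖w i‖ := Finset.prod_pos fun i _ => hpos i
  refine ⟨fun i => φ (w i), fun i => ‖w i‖, hw.map' φ.toLinearMap φ.ker, hwL, hpos, ?_, ?_, ?_⟩
  · intro i k hik
    exact hmin i _ (hwL k) (hw.notMem_span_image (by simpa using hik))
  · intro i
    rw [mem_smul_box_iff _ (hpos i)]
    intro j
    have : |w i j| ≤ ‖w i‖ := by simpa using PiLp.norm_apply_le (w i) j
    change |Real.exp (τ j) * w i j| ≤ _
    rw [abs_mul, Real.abs_exp, mul_comm]
    gcongr
  · have hTc : Continuous T := T.continuous_of_finiteDimensional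
    have hvol : volume (φ '' (T ⁻¹' B)) = ENNReal.ofReal (∏ i, ‖w i‖) * volume B := by
      rw [volume_diagEquiv_image hτ (hTc.measurable measurableSet_ball),
        Measure.addHaar_preimage_linearMap]
      · rw [hdet, Finset.prod_inv_distrib, inv_inv, abs_of_pos hPpos]
      · rw [hdet, Finset.prod_inv_distrib]
        exact inv_ne_zero hPpos.ne'
    -- Otherwise Minkowski's first theorem gives a nonzero `y ∈ L` with `‖T y‖ < 1`, against the
    -- choice of `T`.
    have hle : volume (φ '' (T ⁻¹' B)) ≤ volume F * 2 ^ d := by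
      by_contra! hlt
      have hconv : Convex ℝ (φ '' (T ⁻¹' B)) :=
        ((convex_ball 0 1).linear_preimage T).linear_image φ.toLinearMap
      have hsymm : ∀ x ∈ φ '' (T ⁻¹' B), -x ∈ φ '' (T ⁻¹' B) := by
        rintro _ ⟨x, hx, rfl⟩
        refine ⟨-x, ?_, map_neg φ x⟩
        simpa [hB] using hx
      obtain ⟨x, hx0, y, hy, hyx⟩ := exists_ne_zero_mem_lattice_of_measure_mul_two_pow_lt_measure
        hF hsymm hconv (by simpa using hlt)
      have hyL : y ∈ L := by
        change φ y ∈ Λ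
        rw [hyx]
        exact x.2
      have hy0 : y ≠ 0 := by
        rintro rfl
        exact hx0 (Subtype.ext (by rw [← hyx, map_zero]; rfl))
      have := hT y hyL hy0
      have hy' : ‖T y‖ < 1 := by simpa [hB] using hy
      linarith
    rw [hvol] at hle
    have h := ENNReal.toReal_mono (ENNReal.mul_ne_top hFtop.ne (by simp)) hle
    rw [ENNReal.toReal_mul, ENNReal.toReal_mul, ENNReal.toReal_ofReal hPpos.le,
      ENNReal.toReal_pow] at h
    rw [le_div_iff₀ (ENNReal.toReal_pos hBpos.ne' hBtop)]
    simpa using h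

/-- The dual basis of a basis of `Λ` spans `Λ*`, which is therefore a lattice. -/
theorem isZLattice_dualLattice {d : ℕ} (Λ : Submodule ℤ (Fin d → ℝ))
    [DiscreteTopology Λ] [IsZLattice ℝ Λ] :
    ∃ _ : DiscreteTopology (dualLattice Λ), IsZLattice ℝ (dualLattice Λ) := by
  classical
  let b := (Module.Free.chooseBasis ℤ Λ).ofZLatticeBasis ℝ Λ
  let D : LinearMap.BilinForm ℝ (Fin d → ℝ) := Matrix.toBilin' 1
  have hD : D.Nondegenerate := LinearMap.BilinForm.nondegenerate_toBilin'_of_det_ne_zero' 1 (by simp)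
  have h : dualLattice Λ = Submodule.span ℤ (Set.range (D.dualBasis hD b)) := by
    rw [← LinearMap.BilinForm.dualSubmodule_span_of_basis,
      (Module.Free.chooseBasis ℤ Λ).ofZLatticeBasis_span ℝ]
    ext y
    rw [LinearMap.BilinForm.mem_dualSubmodule]
    refine forall₂_congr fun x _ => ?_
    rw [Submodule.mem_one]
    simp [D, Matrix.toBilin'_apply', dotProduct, eq_comm]
  rw [h]
  exact ⟨inferInstance, inferInstance⟩

end MulGeom

/-! ### Successive minima and duality. -/

namespace MulGeom

open Filter
open scoped Pointwise

section Minima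
variable {d : ℕ}

/-- The set whose infimum is the `k`-th successive minimum. -/
def minimaSet (Λ : Submodule ℤ (Fin d → ℝ)) (B : Set (Fin d → ℝ)) (k : ℕ) : Set ℝ :=
  {r : ℝ | 0 < r ∧ ∃ v : Fin k → (Fin d → ℝ),
    LinearIndependent ℝ v ∧ ∀ i, v i ∈ Λ ∧ v i ∈ r • B}

theorem minimaSet_bddBelow (Λ : Submodule ℤ (Fin d → ℝ)) (B : Set (Fin d → ℝ)) (k : ℕ) :
    BddBelow (minimaSet Λ B k) :=
  ⟨0, fun _ hr => hr.1.le⟩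

theorem minimaSet_anti (Λ : Submodule ℤ (Fin d → ℝ)) (B : Set (Fin d → ℝ)) {k l : ℕ}
    (hkl : k ≤ l) : minimaSet Λ B l ⊆ minimaSet Λ B k := by
  rintro r ⟨hr, v, hv, h⟩
  exact ⟨hr, v ∘ Fin.castLE hkl, hv.comp _ (Fin.castLE_injective hkl), fun i => h _⟩

theorem exists_prod_le_minimaSet (Λ : Submodule ℤ (Fin d → ℝ))
    [DiscreteTopology Λ] [IsZLattice ℝ Λ] :
    ∃ C : ℝ, ∀ τ : Fin d → ℝ, ∑ i, τ i = 0 → ∃ μ : Fin d → ℝ, (∀ i, 0 < μ i) ∧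
      (∀ i : Fin d, μ i ∈ minimaSet Λ (box τ) (i + 1)) ∧ ∏ i, μ i ≤ C := by
  obtain ⟨C, hC⟩ := exists_basis_prod_le Λ
  refine ⟨C, fun τ hτ => ?_⟩
  obtain ⟨v, μ, hv, hvΛ, hμ, hmono, hbox, hprod⟩ := hC τ hτ
  refine ⟨μ, hμ, fun i => ⟨hμ i, v ∘ Fin.castLE i.2, hv.comp _ (Fin.castLE_injective _),
    fun j => ⟨hvΛ _, ?_⟩⟩, hprod⟩
  rw [mem_smul_box_iff _ (hμ i)]
  intro l
  have h := (mem_smul_box_iff _ (hμ _) _).1 (hbox (Fin.castLE i.2 j)) l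
  refine h.trans ?_
  have : μ (Fin.castLE i.2 j) ≤ μ i := hmono (Nat.lt_succ_iff.1 j.2)
  gcongr

theorem minimaSet_nonempty (Λ : Submodule ℤ (Fin d → ℝ))
    [DiscreteTopology Λ] [IsZLattice ℝ Λ] {τ : Fin d → ℝ} (hτ : ∑ i, τ i = 0) {k : ℕ}
    (hk : k ≤ d) : (minimaSet Λ (box τ) k).Nonempty := by
  obtain rfl | hk0 := k.eq_zero_or_pos
  · exact ⟨1, one_pos, Fin.elim0, linearIndependent_empty_type, fun i => i.elim0⟩
  obtain ⟨C, hC⟩ := exists_prod_le_minimaSet Λ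
  obtain ⟨μ, -, hμ, -⟩ := hC τ hτ
  have := hμ ⟨k - 1, by omega⟩
  rw [show k - 1 + 1 = k by omega] at this
  exact ⟨_, this⟩

/-- A nonzero `w` cannot be orthogonal to `d` independent vectors, so some pairing is a nonzero
integer. The weights of the two boxes cancel, leaving `d` summands of size at most `s * r`. Only
integrality of the pairing is assumed, so either of Λ, Λ* may play `M`, without Λ** = Λ. -/
theorem one_le_mul_of_mem_minimaSet {M N : Submodule ℤ (Fin d → ℝ)}
    (hMN : ∀ y ∈ M, ∀ x ∈ N, ∃ n : ℤ, ∑ i, y i * x i = n) {τ σ : Fin d → ℝ}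
    (hστ : ∀ i, σ i + τ i = 0) {r s : ℝ} (hr : r ∈ minimaSet N (box τ) d)
    (hs : s ∈ minimaSet M (box σ) 1) : 1 ≤ d * (s * r) := by
  obtain ⟨hr, v, hv, hvN⟩ := hr
  obtain ⟨hs, w, hw, hwM⟩ := hs
  have hspan : Submodule.span ℝ (Set.range v) = ⊤ :=
    hv.span_eq_top_of_card_eq_finrank' (by simp)
  obtain ⟨k, hk⟩ : ∃ k, w 0 ⬝ᵥ v k ≠ 0 := by
    by_contra! h
    refine hw.ne_zero 0 (dotProduct_eq_zero _ fun z => ?_)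
    have hle : Submodule.span ℝ (Set.range v) ≤ LinearMap.ker (dotProductBilin ℝ ℝ (w 0)) := by
      rw [Submodule.span_le]
      rintro _ ⟨j, rfl⟩
      exact h j
    exact hle (hspan ▸ Submodule.mem_top)
  obtain ⟨n, hn⟩ := hMN _ (hwM 0).1 _ (hvN k).1
  have hw' := (mem_smul_box_iff _ hs _).1 (hwM 0).2
  have hv' := (mem_smul_box_iff _ hr _).1 (hvN k).2
  have hk' : (n : ℝ) ≠ 0 := hn ▸ hk
  have h1 : (1 : ℝ) ≤ |(n : ℝ)| := by
    exact_mod_cast Int.one_le_abs (by exact_mod_cast hk' : n ≠ 0)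
  calc (1 : ℝ) ≤ |∑ i, w 0 i * v k i| := by rwa [hn]
    _ ≤ ∑ i, |w 0 i * v k i| := Finset.abs_sum_le_sum_abs _ _
    _ ≤ ∑ _i : Fin d, s * r := by
      refine Finset.sum_le_sum fun i _ => ?_
      rw [abs_mul]
      calc |w 0 i| * |v k i| ≤ (s * Real.exp (σ i)) * (r * Real.exp (τ i)) :=
            mul_le_mul (hw' i) (hv' i) (abs_nonneg _) (by positivity)
        _ = s * r * Real.exp (σ i + τ i) := by rw [Real.exp_add]; ring
        _ = s * r := by rw [hστ, Real.exp_zero, mul_one]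
    _ = d * (s * r) := by simp

theorem sum_coe_eq_zero (τ : traceZero d) : ∑ i, (τ : Fin d → ℝ) i = 0 := τ.2

theorem sum_neg_coe_eq_zero (τ : traceZero d) : ∑ i, (-(τ : Fin d → ℝ)) i = 0 := (-τ).2

variable (Λ : Submodule ℤ (Fin d → ℝ)) [DiscreteTopology Λ] [IsZLattice ℝ Λ]

/-- Duality bounds the minima below by any admissible radius for Λ*; positivity is what makes the
logarithms meaningful. -/
theorem succMin_pos (τ : traceZero d) {k : ℕ} (hk : 1 ≤ k) (hkd : k ≤ d) :
    0 < succMin Λ (box (τ : Fin d → ℝ)) k := by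
  obtain ⟨_, _⟩ := isZLattice_dualLattice Λ
  obtain ⟨r, hr⟩ := minimaSet_nonempty (dualLattice Λ) (sum_neg_coe_eq_zero τ) le_rfl
  have hd : (0 : ℝ) < d := by exact_mod_cast hk.trans hkd
  have hr0 := hr.1
  refine lt_of_lt_of_le (b := 1 / (d * r)) (by positivity)
    (le_csInf (minimaSet_nonempty Λ (sum_coe_eq_zero τ) hkd) fun s hs => ?_)
  rw [div_le_iff₀ (by positivity)]
  have := one_le_mul_of_mem_minimaSet (M := Λ) (σ := τ) (fun y hy x hx => by
    simpa only [mul_comm] using hx y hy) (fun i => by simp) hr (minimaSet_anti _ _ hk hs)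
  linarith

theorem logMin_mono (τ : traceZero d) {k l : ℕ} (hk : 1 ≤ k) (hkl : k ≤ l) (hl : l ≤ d) :
    logMin Λ k τ ≤ logMin Λ l τ :=
  Real.log_le_log (succMin_pos Λ τ hk (hkl.trans hl))
    (csInf_le_csInf (minimaSet_bddBelow _ _ _) (minimaSet_nonempty Λ (sum_coe_eq_zero τ) hl)
      (minimaSet_anti _ _ hkl))

theorem exists_sum_logMin_le :
    ∃ C : ℝ, ∀ τ : traceZero d, ∑ k ∈ Finset.Icc 1 d, logMin Λ k τ ≤ C := by
  obtain ⟨C, hC⟩ := exists_prod_le_minimaSet Λ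
  refine ⟨Real.log C, fun τ => ?_⟩
  obtain ⟨μ, hμ, hmem, hprod⟩ := hC τ (sum_coe_eq_zero τ)
  have h1 : ∑ k ∈ Finset.Icc 1 d, logMin Λ k τ = ∑ i : Fin d, logMin Λ (i + 1) τ := by
    rw [Fin.sum_univ_eq_sum_range (fun i => logMin Λ (i + 1) τ),
      Finset.range_eq_Ico, Finset.sum_Ico_add' (fun i => logMin Λ i τ) 0 d 1]
    rfl
  calc _ ≤ ∑ i, Real.log (μ i) := by
        rw [h1]
        exact Finset.sum_le_sum fun i _ => Real.log_le_log (succMin_pos Λ τ (by omega) i.2)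
          (csInf_le (minimaSet_bddBelow _ _ _) (hmem i))
    _ = Real.log (∏ i, μ i) := (Real.log_prod fun i _ => (hμ i).ne').symm
    _ ≤ _ := Real.log_le_log (Finset.prod_pos fun i _ => hμ i) hprod

/-- The least of `d` numbers is at most their mean. -/
theorem exists_logMin_one_le (hd : 1 ≤ d) : ∃ C : ℝ, ∀ τ : traceZero d, logMin Λ 1 τ ≤ C := by
  obtain ⟨C, hC⟩ := exists_sum_logMin_le Λ
  refine ⟨C / d, fun τ => ?_⟩
  rw [le_div_iff₀ (by exact_mod_cast hd)]
  have h := Finset.card_nsmul_le_sum (Finset.Icc 1 d) (fun k => logMin Λ k τ) (logMin Λ 1 τ)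
    fun k hk => logMin_mono Λ τ le_rfl (Finset.mem_Icc.1 hk).1 (Finset.mem_Icc.1 hk).2
  rw [Nat.card_Icc, Nat.add_sub_cancel, nsmul_eq_mul, mul_comm] at h
  exact h.trans (hC τ)

theorem neg_log_le_logMin_add (hd : 1 ≤ d) (τ : traceZero d) :
    -Real.log d ≤ logMin (dualLattice Λ) 1 τ + logMin Λ d (-τ) := by
  obtain ⟨_, _⟩ := isZLattice_dualLattice Λ
  have hd0 : (0 : ℝ) < d := by exact_mod_cast hd
  have h1 := succMin_pos (dualLattice Λ) τ le_rfl hd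
  have h2 := succMin_pos Λ (-τ) hd le_rfl
  have key : 1 / d ≤ succMin (dualLattice Λ) (box (τ : Fin d → ℝ)) 1 *
      succMin Λ (box ((-τ : traceZero d) : Fin d → ℝ)) d := by
    rw [← div_le_iff₀ h2]
    refine le_csInf (minimaSet_nonempty (dualLattice Λ) (sum_coe_eq_zero τ) hd) fun s hs => ?_
    have hs0 := hs.1
    rw [div_le_iff₀ h2, ← div_le_iff₀' hs0]
    refine le_csInf (minimaSet_nonempty Λ (sum_coe_eq_zero (-τ)) le_rfl) fun r hr => ?_
    have := one_le_mul_of_mem_minimaSet (M := dualLattice Λ) (σ := τ)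
      (fun y hy x hx => hy x hx) (fun i => by simp) hr hs
    rw [div_le_iff₀' hs0, div_le_iff₀' hd0]
    exact this
  have := Real.log_le_log (by positivity) key
  rwa [Real.log_mul h1.ne' h2.ne', one_div, Real.log_inv] at this

theorem exists_sum_logMin_neg_le (hd : 1 ≤ d) : ∃ C : ℝ, ∀ τ : traceZero d,
    ∑ k ∈ Finset.Icc 1 (d - 1), logMin Λ k (-τ) ≤ C + logMin (dualLattice Λ) 1 τ := by
  obtain ⟨C, hC⟩ := exists_sum_logMin_le Λ
  refine ⟨C + Real.log d, fun τ => ?_⟩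
  have h1 := hC (-τ)
  have h2 := neg_log_le_logMin_add Λ hd τ
  obtain ⟨e, rfl⟩ : ∃ e, d = e + 1 := ⟨d - 1, by omega⟩
  rw [Finset.sum_Icc_succ_top (by omega)] at h1
  rw [Nat.add_sub_cancel]
  linarith

end Minima

/-! ### Comparing |τ|_+, |-τ|_+ and the norm. -/

section PlusPart
variable {d : ℕ}

theorem coe_le_plusPart (τ : traceZero d) (i : Fin d) : (τ : Fin d → ℝ) i ≤ plusPart τ :=
  le_ciSup (Set.finite_range _).bddAbove i

/-- As the coordinates sum to zero, `-τ i` is the sum of the other `d - 1`. -/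
theorem neg_coe_le_plusPart (τ : traceZero d) (i : Fin d) :
    -(τ : Fin d → ℝ) i ≤ ((d : ℝ) - 1) * plusPart τ := by
  have h := sum_coe_eq_zero τ
  rw [← Finset.add_sum_erase _ _ (Finset.mem_univ i)] at h
  have h2 := Finset.sum_le_card_nsmul (Finset.univ.erase i) (fun j => (τ : Fin d → ℝ) j)
    (plusPart τ) fun j _ => coe_le_plusPart τ j
  rw [Finset.card_erase_of_mem (Finset.mem_univ i), Finset.card_univ, Fintype.card_fin,
    nsmul_eq_mul, Nat.cast_pred i.pos] at h2
  linarith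

theorem plusPart_nonneg (hd : 1 ≤ d) (τ : traceZero d) : 0 ≤ plusPart τ := by
  have h := neg_coe_le_plusPart τ ⟨0, hd⟩
  have h2 := coe_le_plusPart τ ⟨0, hd⟩
  have hd0 : (0 : ℝ) < d := by exact_mod_cast hd
  refine nonneg_of_mul_nonneg_right (a := (d : ℝ)) ?_ hd0
  linarith

theorem plusPart_neg_le (hd : 1 ≤ d) (τ : traceZero d) :
    plusPart (-τ) ≤ ((d : ℝ) - 1) * plusPart τ := by
  have : Nonempty (Fin d) := ⟨⟨0, hd⟩⟩
  exact ciSup_le fun i => neg_coe_le_plusPart τ i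

theorem norm_le_plusPart (hd : 2 ≤ d) (τ : traceZero d) :
    ‖τ‖ ≤ ((d : ℝ) - 1) * plusPart τ := by
  have h0 := plusPart_nonneg (by omega) τ
  have hd' : (2 : ℝ) ≤ d := by exact_mod_cast hd
  refine (pi_norm_le_iff_of_nonneg (mul_nonneg (by linarith) h0)).2 fun i => ?_
  rw [Real.norm_eq_abs, abs_le']
  refine ⟨(coe_le_plusPart τ i).trans ?_, neg_coe_le_plusPart τ i⟩
  nlinarith

end PlusPart

/-! ### Passing to lower limits. -/

section Exponents
variable {d : ℕ}

theorem bigPsi_eq (Λ : Submodule ℤ (Fin d → ℝ)) (f : traceZero d → ℝ) (k : ℕ) (τ : traceZero d) :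
    bigPsi Λ f k τ = (∑ j ∈ Finset.Icc 1 k, logMin Λ j τ) / f τ := by
  simp only [bigPsi, psi, Finset.sum_div]

theorem neBot_comap_norm (hd : 2 ≤ d) : (comap (fun τ : traceZero d => ‖τ‖) atTop).NeBot := by
  have : Nontrivial (traceZero d) := by
    refine ⟨⟨Pi.single ⟨0, by omega⟩ 1 - Pi.single ⟨1, by omega⟩ 1, ?_⟩, 0, ?_⟩
    · change ∑ i, _ = _
      simp
    · intro h
      have := congrFun (congrArg Subtype.val h) ⟨0, by omega⟩
      simp at this
  rw [comap_norm_atTop]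
  exact NormedSpace.cobounded_neBot ℝ (traceZero d)

theorem liminf_div_const {α : Type*} (F : Filter α) [F.NeBot] (g : α → ℝ) {c : ℝ} (hc : 0 < c) :
    liminf (fun x => ((g x / c : ℝ) : EReal)) F = liminf (fun x => (g x : EReal)) F / (c : EReal) := by
  have h := EReal.liminf_const_mul_of_nonneg_of_ne_top (f := F) (u := fun x => (g x : EReal))
    (c := ((c⁻¹ : ℝ) : EReal)) (by exact_mod_cast (inv_pos.2 hc).le) (EReal.coe_ne_top _)
  rw [EReal.div_eq_inv_mul, ← EReal.coe_inv, ← h]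
  congr 1
  ext x
  rw [← EReal.coe_mul, div_eq_inv_mul]

variable (Λ : Submodule ℤ (Fin d → ℝ)) [DiscreteTopology Λ] [IsZLattice ℝ Λ]

theorem lowerExponent_div_le_succ (hd : 2 ≤ d) {k : ℕ} (hk : 1 ≤ k) (hkd : k + 1 ≤ d) :
    lowerExponent Λ plusPart k / ((k : ℝ) : EReal) ≤
      lowerExponent Λ plusPart (k + 1) / (((k : ℝ) + 1 : ℝ) : EReal) := by
  have := neBot_comap_norm hd
  have hk0 : (0 : ℝ) < k := by exact_mod_cast hk
  rw [lowerExponent, lowerExponent, ← liminf_div_const _ _ hk0,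
    ← liminf_div_const _ _ (by positivity : (0 : ℝ) < k + 1)]
  refine liminf_le_liminf (Eventually.of_forall fun τ => EReal.coe_le_coe_iff.2 ?_)
  have h := Finset.sum_le_card_nsmul (Finset.Icc 1 k) (fun j => logMin Λ j τ)
    (logMin Λ (k + 1) τ) fun j hj => logMin_mono Λ τ (Finset.mem_Icc.1 hj).1
      ((Finset.mem_Icc.1 hj).2.trans k.le_succ) hkd
  rw [Nat.card_Icc, Nat.add_sub_cancel, nsmul_eq_mul] at h
  rw [bigPsi_eq, bigPsi_eq, Finset.sum_Icc_succ_top (by omega), div_right_comm,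
    div_right_comm _ _ ((k : ℝ) + 1)]
  refine div_le_div_of_nonneg_right ?_ (plusPart_nonneg (by omega) τ)
  rw [div_le_div_iff₀ hk0 (by positivity)]
  nlinarith

theorem lowerExponent_one_le (hd : 2 ≤ d) {k : ℕ} (hk : 1 ≤ k) (hkd : k ≤ d) :
    lowerExponent Λ plusPart 1 ≤ lowerExponent Λ plusPart k / ((k : ℝ) : EReal) := by
  induction k, hk using Nat.le_induction with
  | base => simp
  | succ k hk ih =>
    have h := lowerExponent_div_le_succ Λ hd hk hkd
    exact (ih (by omega)).trans (by exact_mod_cast h)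

/-- The transference inequality between `Λ` and `Λ*`. -/
theorem lowerExponent_le_dual (hd : 2 ≤ d) :
    lowerExponent Λ plusPart (d - 1) ≤
      lowerExponent (dualLattice Λ) plusPart 1 / (((d : ℝ) - 1 : ℝ) : EReal) := by
  obtain ⟨_, _⟩ := isZLattice_dualLattice Λ
  have := neBot_comap_norm hd
  have hd' : (0 : ℝ) < (d : ℝ) - 1 := by
    have : (2 : ℝ) ≤ d := by exact_mod_cast hd
    linarith
  set F := comap (fun τ : traceZero d => ‖τ‖) atTop with hF
  obtain ⟨C₁, hC₁⟩ := exists_sum_logMin_neg_le Λ (by omega)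
  obtain ⟨C₂, hC₂⟩ := exists_logMin_one_le (dualLattice Λ) (by omega)
  set K := |C₁| + |C₂| with hK
  have hneg : Tendsto (fun τ : traceZero d => -τ) F F := by
    rw [hF, tendsto_comap_iff]
    simp only [Function.comp_def, norm_neg]
    exact tendsto_comap
  have hε : Tendsto (fun τ : traceZero d => ((K * ((d : ℝ) - 1) / ‖τ‖ : ℝ) : EReal)) F (nhds 0) := by
    rw [← EReal.coe_zero, EReal.tendsto_coe]
    exact tendsto_comap.const_div_atTop _
  have hpos : ∀ᶠ τ : traceZero d in F, 0 < ‖τ‖ := tendsto_comap.eventually_gt_atTop 0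
  have hpt : ∀ᶠ τ in F, (bigPsi Λ plusPart (d - 1) (-τ) : EReal) ≤
      ((K * ((d : ℝ) - 1) / ‖τ‖ : ℝ) : EReal) +
        ((bigPsi (dualLattice Λ) plusPart 1 τ / ((d : ℝ) - 1) : ℝ) : EReal) := by
    filter_upwards [hpos] with τ hτ
    rw [← EReal.coe_add, EReal.coe_le_coe_iff, bigPsi_eq, bigPsi_eq, Finset.Icc_self,
      Finset.sum_singleton]
    have hP : 0 < plusPart τ :=
      pos_of_mul_pos_right (hτ.trans_le (norm_le_plusPart hd τ)) hd'.le
    have hQn : ‖τ‖ ≤ ((d : ℝ) - 1) * plusPart (-τ) := by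
      simpa using norm_le_plusPart hd (-τ)
    have hQ : 0 < plusPart (-τ) := pos_of_mul_pos_right (hτ.trans_le hQn) hd'.le
    have hQP := plusPart_neg_le (by omega) τ
    set l := logMin (dualLattice Λ) 1 τ
    -- A nonpositive numerator is needed so that enlarging the denominator from |-τ|_+ to (d-1)|τ|_+
    -- increases the quotient; the shift is absorbed in `K`.
    have hl : l - |C₂| ≤ 0 := by linarith [hC₂ τ, le_abs_self C₂]
    calc _ ≤ (K + (l - |C₂|)) / plusPart (-τ) := by
          have := hC₁ τ
          have := le_abs_self C₁
          gcongr
          linarith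
      _ = K / plusPart (-τ) + (l - |C₂|) / plusPart (-τ) := add_div _ _ _
      _ ≤ K * ((d : ℝ) - 1) / ‖τ‖ + (l - |C₂|) / (((d : ℝ) - 1) * plusPart τ) := by
          refine add_le_add ?_ ?_
          · rw [div_le_div_iff₀ hQ hτ, mul_assoc]
            gcongr
          · rw [div_le_div_iff₀ hQ (by positivity)]
            exact mul_le_mul_of_nonpos_left hQP hl
      _ ≤ K * ((d : ℝ) - 1) / ‖τ‖ + l / plusPart τ / ((d : ℝ) - 1) := by
          rw [div_div, mul_comm (plusPart τ)]
          gcongr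
          linarith [abs_nonneg C₂]
  -- The reflection `τ ↦ -τ` preserves the filter, so the bound at `-τ` controls the exponent
  -- itself.
  calc lowerExponent Λ plusPart (d - 1)
      ≤ liminf (fun τ => (bigPsi Λ plusPart (d - 1) (-τ) : EReal)) F :=
        hneg.liminf_le_liminf_comp
    _ ≤ _ := liminf_le_liminf hpt
    _ ≤ limsup (fun τ : traceZero d => ((K * ((d : ℝ) - 1) / ‖τ‖ : ℝ) : EReal)) F +
        liminf (fun τ => ((bigPsi (dualLattice Λ) plusPart 1 τ / ((d : ℝ) - 1) : ℝ) : EReal)) F :=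
        EReal.liminf_add_le (Or.inl (hε.limsup_eq ▸ EReal.zero_ne_bot))
          (Or.inl (hε.limsup_eq ▸ EReal.zero_ne_top))
    _ = _ := by rw [hε.limsup_eq, zero_add, liminf_div_const _ _ hd']; rfl

end Exponents

end MulGeom

theorem theoremt (d : ℕ) (hd : 2 ≤ d) (Λ : Submodule ℤ (Fin d → ℝ))
    [DiscreteTopology Λ] [IsZLattice ℝ Λ] (hΛ : ZLattice.covolume Λ = 1) :
    (∀ k : ℕ, 1 ≤ k → k + 1 ≤ d - 1 →
      MulGeom.lowerExponent Λ MulGeom.plusPart k / ((k : ℝ) : EReal) ≤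
        MulGeom.lowerExponent Λ MulGeom.plusPart (k + 1) / (((k : ℝ) + 1 : ℝ) : EReal)) ∧
    MulGeom.lowerExponent Λ MulGeom.plusPart (d - 1) / (((d : ℝ) - 1 : ℝ) : EReal) ≤
      MulGeom.lowerExponent (MulGeom.dualLattice Λ) MulGeom.plusPart 1 /
        ((((d : ℝ) - 1) ^ 2 : ℝ) : EReal) ∧
    MulGeom.lowerExponent Λ MulGeom.plusPart 1 ≤
      MulGeom.lowerExponent (MulGeom.dualLattice Λ) MulGeom.plusPart 1 /
        ((((d : ℝ) - 1) ^ 2 : ℝ) : EReal) := by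
  have hd' : (0 : ℝ) ≤ (d : ℝ) - 1 := by
    have : (2 : ℝ) ≤ d := by exact_mod_cast hd
    linarith
  have h : MulGeom.lowerExponent Λ MulGeom.plusPart (d - 1) / (((d : ℝ) - 1 : ℝ) : EReal) ≤
      MulGeom.lowerExponent (MulGeom.dualLattice Λ) MulGeom.plusPart 1 /
        ((((d : ℝ) - 1) ^ 2 : ℝ) : EReal) := by
    -- One factor `d - 1` comes from transference, the other from the average on the left.
    rw [pow_two, EReal.coe_mul, ← EReal.div_div]
    exact EReal.div_le_div_right_of_nonneg (by exact_mod_cast hd')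
      (MulGeom.lowerExponent_le_dual Λ hd)
  refine ⟨fun k hk hkd => MulGeom.lowerExponent_div_le_succ Λ hd hk (by omega), h, ?_⟩
  have h1 := MulGeom.lowerExponent_one_le Λ hd (k := d - 1) (by omega) (by omega)
  rw [Nat.cast_pred (by omega)] at h1
  exact h1.trans h
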